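/- Let $p$ be a prime number and let $R$ be a perfectoid ring. Here, for a commutative ring $R$, the tilt is the ring $R^\flat=\lim(R/p\xleftarrow{\varphi}R/p\xleftarrow{\varphi}\cdots)$ with $\varphi(x)=x^p$, and $A_{\inf}(R)=W(R^\flat)$ is its ring of $p$-typical Witt vectors. If $R$ is $p$-adically complete and separated, then $\theta\colon A_{\inf}(R)\to R$ denotes Fontaine's ring homomorphism $\theta(\sum_{i\ge 0}[a_i]p^i)=\sum_{i\ge0}a_i^{\#}p^i$, where $a^{\#}=\lim_{n\to\infty}y_n^{p^n}$ for any lifts $y_n\in R$ of the components $x_n\in R/p$ of $a=(x_0,x_1,\dots)\in R^\flat$. The ring $R$ is perfectoid if there is $\pi\in R$ with $p\in\pi^pR$ such that $R$ is complete and separated in the $\pi$-adic topology (hence also in the $p$-adic one), the Frobenius $\varphi\colon R/p\to R/p$ is surjective, and $\ker(\theta)$ is a principal ideal. Then $\theta\colon A_{\inf}(R)\to R$ is the initial object among the surjective ring homomorphisms $\theta_D\colon D\to R$ from commutative rings $D$ such that $D$ is complete and separated in both the $p$-adic topology and the $\ker(\theta_D)$-adic topology. That is: $\theta$ is surjective;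 $A_{\inf}(R)$ is complete and separated in both the $p$-adic and the $\ker(\theta)$-adic topology; and for every such $\theta_D\colon D\to R$ there is a unique ring homomorphism $f\colon A_{\inf}(R)\to D$ with $\theta_D\circ f=\theta$. -/

import Mathlib

noncomputable section

namespace FontaineAInf

section Tilt

variable (p : ℕ) [Fact p.Prime] (R : Type*) [CommRing R]

/-- The quotient ring `R / pR`. -/
abbrev ModP : Type _ := R ⧸ Ideal.span {(p : R)}

/-- `R / pR` is the zero ring or has characteristic `p`. -/
theorem subsingleton_or_charP : Subsingleton (ModP p R) ∨ CharP (ModP p R) p := by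
  by_cases h : IsUnit (p : R)
  · left
    rw [Ideal.Quotient.subsingleton_iff]
    exact Ideal.span_singleton_eq_top.mpr h
  · right
    have : Fact (¬ IsUnit (p : R)) := ⟨h⟩
    exact inferInstanceAs (CharP (_root_.ModP R p) p)

/-- The Frobenius endomorphism `x ↦ x ^ p` of `R / pR`. -/
def frob : ModP p R →+* ModP p R where
  toFun x := x ^ p
  map_one' := one_pow _
  map_mul' x y := mul_pow x y p
  map_zero' := zero_pow (Fact.out : p.Prime).ne_zero
  map_add' x y := by
    rcases subsingleton_or_charP p R with h | h
    · exact Subsingleton.elim _ _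
    · exact add_pow_char x y p

/-- The subring of sequences `(x₀, x₁, …)` in `R / pR` with `x_{n+1} ^ p = x_n`. -/
def tiltSubring : Subring (ℕ → ModP p R) where
  carrier := {x | ∀ n, x (n + 1) ^ p = x n}
  one_mem' _ := one_pow _
  mul_mem' hx hy n := (mul_pow _ _ _).trans congr($(hx n) * $(hy n))
  zero_mem' _ := zero_pow (Fact.out : p.Prime).ne_zero
  add_mem' hx hy n := (map_add (frob p R) _ _).trans congr($(hx n) + $(hy n))
  neg_mem' hx n := (map_neg (frob p R) _).trans congr(-$(hx n))

/-- The tilt `R♭`, the limit of `R/p ← R/p ← R/p ← ⋯` along the Frobenius. For `R` with `p` not a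
unit it is Mathlib's `PreTilt R p`; that type is a ring only if `p` is not a unit, which would
exclude the zero ring. -/
abbrev Tilt : Type _ := tiltSubring p R

variable {R} in
/-- The projection `R♭ → R / pR`, `(x₀, x₁, …) ↦ x_n`. -/
def Tilt.coeff (n : ℕ) : Tilt p R →+* ModP p R :=
  (Pi.evalRingHom _ n).comp (tiltSubring p R).subtype

/-- Fontaine's ring of `p`-adic periods `A_inf(R) = W(R♭)`, the `p`-typical Witt vectors. -/
abbrev AInf : Type _ := WittVector p (Tilt p R)

end Tilt

section Theta

variable (p : ℕ) [Fact p.Prime] (R : Type*) [CommRing R]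

/-- Fontaine's map modulo `p ^ (n + 1)`: the composite of the map `W(R♭) → W(R/p)` induced by
`(x₀, x₁, …) ↦ x_n` with the map `W(R/p) → R / p ^ (n + 1)` through which the `n`-th ghost
component `W(R) → R → R / p ^ (n + 1)` factors. -/
def thetaMod (n : ℕ) : AInf p R →+* R ⧸ Ideal.span {(p : R)} ^ (n + 1) :=
  (WittVector.ghostComponentModPPow n).comp (WittVector.map (Tilt.coeff p n))

/-- The Witt vector Frobenius of `W(R/p)` is induced by the Frobenius of `R/p`. -/
theorem frobenius_eq_map_frob (y : WittVector p (ModP p R)) :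
    WittVector.frobenius y = WittVector.map (frob p R) y := by
  rcases subsingleton_or_charP p R with h | h
  · ext n
    exact Subsingleton.elim _ _
  · ext n
    rw [WittVector.coeff_frobenius_charP, WittVector.map_coeff]
    rfl

theorem thetaMod_compatible (n : ℕ) :
    (Ideal.Quotient.factorPowSucc (Ideal.span {(p : R)}) (n + 1)).comp (thetaMod p R (n + 1)) =
      thetaMod p R n := by
  ext x
  have h1 : WittVector.map (Tilt.coeff p n) x =
      WittVector.frobenius (WittVector.map (Tilt.coeff (R := R) p (n + 1)) x) := by
    rw [frobenius_eq_map_frob]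
    ext k
    simp only [WittVector.map_coeff]
    exact ((x.coeff k).2 n).symm
  obtain ⟨y, hy⟩ := WittVector.map_surjective (p := p) (Ideal.Quotient.mk (Ideal.span {(p : R)}))
    Ideal.Quotient.mk_surjective (WittVector.map (Tilt.coeff (R := R) p (n + 1)) x)
  have h2 : WittVector.map (Tilt.coeff p n) x =
      WittVector.map (Ideal.Quotient.mk (Ideal.span {(p : R)})) (WittVector.frobenius y) := by
    rw [h1, ← hy]
    exact ((WittVector.frobenius_isPoly p).map _ y).symm
  simp only [thetaMod, RingHom.comp_apply]
  rw [h2, ← hy, WittVector.ghostComponentModPPow_map_mk, WittVector.ghostComponentModPPow_map_mk,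
    WittVector.ghostComponent_frobenius]
  rfl

/-- Fontaine's map `θ : A_inf(R) → R` for a `p`-adically complete and separated ring `R`, the limit
of the maps `thetaMod p R n`. -/
def theta [IsAdicComplete (Ideal.span {(p : R)}) R] : AInf p R →+* R :=
  IsAdicComplete.StrictMono.liftRingHom (Ideal.span {(p : R)}) Order.succ_strictMono
    (fun n ↦ thetaMod p R n) (fun {n} ↦ thetaMod_compatible p R n)

theorem mk_theta [IsAdicComplete (Ideal.span {(p : R)}) R] (n : ℕ) (x : AInf p R) :
    Ideal.Quotient.mk (Ideal.span {(p : R)} ^ (n + 1)) (theta p R x) = thetaMod p R n x :=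
  IsAdicComplete.StrictMono.mk_liftRingHom (Ideal.span {(p : R)}) Order.succ_strictMono
    (fun n ↦ thetaMod p R n) (fun {n} ↦ thetaMod_compatible p R n) x

/-- `θ([a]) = a^♯ = lim y_n ^ (p ^ n)` for any lifts `y_n` of the components of `a`. Together with
additivity and `p`-adic continuity this is the formula `θ(∑ [a_i] p^i) = ∑ a_i^♯ p^i`. -/
theorem mk_theta_teichmuller [IsAdicComplete (Ideal.span {(p : R)}) R] (n : ℕ) (a : Tilt p R)
    (y : R) (hy : Ideal.Quotient.mk (Ideal.span {(p : R)}) y = Tilt.coeff p n a) :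
    Ideal.Quotient.mk (Ideal.span {(p : R)} ^ (n + 1)) (theta p R (WittVector.teichmuller p a)) =
      Ideal.Quotient.mk (Ideal.span {(p : R)} ^ (n + 1)) (y ^ p ^ n) := by
  rw [mk_theta, thetaMod, RingHom.comp_apply, WittVector.map_teichmuller, ← hy,
    ← WittVector.map_teichmuller, WittVector.ghostComponentModPPow_map_mk,
    WittVector.ghostComponent_teichmuller]

end Theta

section Perfectoid

/-- If `R` is `π`-adically complete and separated and `p ∈ π R`, then `R` is `p`-adically complete
and separated. -/
theorem isAdicComplete_of_mem {R : Type*} [CommRing R] {π q : R} (hq : q ∈ Ideal.span {π})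
    (h : IsAdicComplete (Ideal.span {π}) R) : IsAdicComplete (Ideal.span {q}) R := by
  have hle : Ideal.span {q} ≤ Ideal.span {π} := by
    rwa [Ideal.span_singleton_le_iff_mem]
  have key : ∀ (r x y : R) (n : ℕ),
      x ≡ y [SMOD (Ideal.span {r} ^ n • ⊤ : Submodule R R)] ↔ r ^ n ∣ x - y := by
    intro r x y n
    rw [SModEq.sub_mem, smul_eq_mul, Ideal.mul_top, Ideal.span_singleton_pow,
      Ideal.mem_span_singleton]
  have hdvd : π ∣ q := Ideal.mem_span_singleton.mp hq
  refine { haus' := fun x hx ↦ ?_, prec' := fun f hf ↦ ?_ }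
  · refine h.haus' x fun n ↦ ?_
    rw [key]
    exact (pow_dvd_pow_of_dvd hdvd n).trans ((key _ _ _ _).mp (hx n))
  · have h1 : ∀ n, ∃ g, f (n + 1) - f n = q ^ n * g := fun n ↦ by
      obtain ⟨g, hg⟩ := (key _ _ _ _).mp (hf (Nat.le_succ n))
      exact ⟨-g, by linear_combination -hg⟩
    choose g hg using h1
    -- the tails of the series of successive differences, divided by `q ^ n`
    have h2 : ∀ n, ∃ L, ∀ m, π ^ m ∣ (∑ k ∈ Finset.range m, q ^ k * g (n + k)) - L := fun n ↦ by
      obtain ⟨L, hL⟩ := h.prec' (fun m ↦ ∑ k ∈ Finset.range m, q ^ k * g (n + k)) (by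
        intro a b hab
        rw [key, ← dvd_neg, neg_sub, ← Finset.sum_range_add_sum_Ico _ hab, add_sub_cancel_left]
        refine Finset.dvd_sum fun k hk ↦ Dvd.dvd.mul_right ?_ _
        exact (pow_dvd_pow π (Finset.mem_Ico.mp hk).1).trans (pow_dvd_pow_of_dvd hdvd k))
      exact ⟨L, fun m ↦ (key _ _ _ _).mp (hL m)⟩
    choose L hL using h2
    have h3 : ∀ n m, f (n + m) - f n = q ^ n * ∑ k ∈ Finset.range m, q ^ k * g (n + k) := by
      intro n m
      induction m with
      | zero => simp
      | succ m ih =>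
        rw [Finset.sum_range_succ, mul_add, ← ih, ← add_assoc]
        have := hg (n + m)
        rw [pow_add] at this
        linear_combination this
    refine ⟨f 0 + L 0, fun n ↦ ?_⟩
    rw [key]
    refine ⟨-L n, ?_⟩
    rw [← sub_eq_zero]
    refine h.haus' _ fun m ↦ ?_
    rw [key, sub_zero]
    have e0 := h3 0 (n + m)
    have en := h3 n m
    simp only [zero_add, pow_zero, one_mul] at e0
    obtain ⟨c, hc⟩ := hL 0 (n + m)
    obtain ⟨d, hd⟩ := hL n m
    simp only [zero_add] at hc
    refine ⟨π ^ n * c - q ^ n * d, ?_⟩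
    rw [pow_add] at hc
    linear_combination hc - q ^ n * hd + e0 - en

theorem isAdicComplete_of_exists_pi {p : ℕ} [Fact p.Prime] {R : Type*} [CommRing R]
    (h : ∃ π : R, (p : R) ∈ Ideal.span {π ^ p} ∧ IsAdicComplete (Ideal.span {π}) R) :
    IsAdicComplete (Ideal.span {(p : R)}) R := by
  obtain ⟨π, hp, h⟩ := h
  refine isAdicComplete_of_mem ?_ h
  refine Ideal.span_singleton_le_span_singleton.mpr ?_ hp
  exact dvd_pow_self π (Fact.out : p.Prime).ne_zero

/-- A commutative ring `R` is perfectoid (with respect to the prime `p`) if there is `π ∈ R` with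
`p ∈ π ^ p R` such that `R` is complete and separated in the `π`-adic topology, the Frobenius of
`R / pR` is surjective, and the kernel of `θ : A_inf(R) → R` is a principal ideal. -/
structure IsPerfectoid (p : ℕ) [Fact p.Prime] (R : Type*) [CommRing R] : Prop where
  exists_pi : ∃ π : R, (p : R) ∈ Ideal.span {π ^ p} ∧ IsAdicComplete (Ideal.span {π}) R
  frob_surjective : Function.Surjective (frob p R)
  ker_theta : haveI := isAdicComplete_of_exists_pi exists_pi
    (RingHom.ker (theta p R)).IsPrincipal

/-- Fontaine's map `θ : A_inf(R) → R` of a perfectoid ring. -/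
def IsPerfectoid.theta {p : ℕ} [Fact p.Prime] {R : Type*} [CommRing R]
    (hR : IsPerfectoid p R) : AInf p R →+* R :=
  haveI := isAdicComplete_of_exists_pi hR.exists_pi
  FontaineAInf.theta p R

/-- A `p`-complete pro-infinitesimal thickening of `R`: a surjective ring homomorphism
`θ_D : D → R` such that `D` is complete and separated in both the `p`-adic and the
`ker(θ_D)`-adic topology. -/
structure IsProInfThickening (p : ℕ) {D R : Type*} [CommRing D] [CommRing R]
    (θD : D →+* R) : Prop where
  surjective : Function.Surjective θD
  p_complete : IsAdicComplete (Ideal.span {(p : D)}) D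
  ker_complete : IsAdicComplete (RingHom.ker θD) D

end Perfectoid

end FontaineAInf

end

noncomputable section

namespace FontaineAInf

/-! ### Adic completeness, and its transfer from a quotient -/

section AdicComplete

variable {A : Type*} [CommRing A]

/-! Maps out of `AInf p R` are controlled by tilts. A thickening `D → R` induces an isomorphism `D♭
≃ R♭` (`tiltMap_injective`, `tiltMap_surjective`). Composing Fontaine's map of `D` with the Witt
functor of its inverse gives `f`, which lies over `R` because Fontaine's map is natural
(`map_theta`). For uniqueness, the images modulo `p` of the elements `[a^(1/p^n)]` form the preimage
of `a` in `D♭`. Raising to `p ^ n`-th powers turns congruences modulo `p` into congruences modulo `p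
^ (n + 1)`, so `f` is determined on Teichmüller elements.

That `θ` is itself a thickening rests on a generator `ξ` of its kernel. The ring `W(R♭)` is
`p`-complete with quotient `R♭`, which is `ξ₀`-adically complete because `ξ₀` generates the kernel
of `R♭ → R/p`. The perfectoid condition on `π` makes `ξ₁` a unit, so `ξ` is a nonzerodivisor, and
`isAdicComplete_span_of_ker_eq` lifts completeness from `R♭` to `W(R♭)`. -/

theorem eq_zero_of_forall_mem_pow {I : Ideal A} [h : IsAdicComplete I A] {x : A}
    (hx : ∀ n, x ∈ I ^ n) : x = 0 :=
  h.haus' x fun n ↦ by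
    rw [SModEq.sub_mem, smul_eq_mul, Ideal.mul_top, sub_zero]
    exact hx n

theorem exists_forall_sub_mem_pow (I : Ideal A) [h : IsAdicComplete I A] (f : ℕ → A)
    (hf : ∀ n, f (n + 1) - f n ∈ I ^ n) : ∃ L, ∀ n, f n - L ∈ I ^ n := by
  have key : ∀ m k, f (m + k) - f m ∈ I ^ m := by
    intro m k
    induction k with
    | zero => simp
    | succ k ih =>
      have h1 := Ideal.pow_le_pow_right (Nat.le_add_right m k) (hf (m + k))
      have := add_mem h1 ih
      rwa [sub_add_sub_cancel] at this
  obtain ⟨L, hL⟩ := h.prec' f fun {m n} hmn ↦ by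
    rw [SModEq.sub_mem, smul_eq_mul, Ideal.mul_top, ← neg_mem_iff, neg_sub]
    obtain ⟨k, rfl⟩ := Nat.exists_eq_add_of_le hmn
    exact key m k
  refine ⟨L, fun n ↦ ?_⟩
  have := hL n
  rwa [SModEq.sub_mem, smul_eq_mul, Ideal.mul_top] at this

theorem isAdicComplete_of_forall {I : Ideal A} (h1 : ∀ x, (∀ n, x ∈ I ^ n) → x = 0)
    (h2 : ∀ f : ℕ → A, (∀ n, f (n + 1) - f n ∈ I ^ n) → ∃ L, ∀ n, f n - L ∈ I ^ n) :
    IsAdicComplete I A where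
  haus' x hx := h1 x fun n ↦ by
    have := hx n
    rwa [SModEq.sub_mem, smul_eq_mul, Ideal.mul_top, sub_zero] at this
  prec' f hf := by
    obtain ⟨L, hL⟩ := h2 f fun n ↦ by
      have := hf (Nat.le_succ n)
      rwa [SModEq.sub_mem, smul_eq_mul, Ideal.mul_top, ← neg_mem_iff, neg_sub] at this
    refine ⟨L, fun n ↦ ?_⟩
    rw [SModEq.sub_mem, smul_eq_mul, Ideal.mul_top]
    exact hL n

theorem mem_span_singleton_pow {a x : A} {n : ℕ} : x ∈ Ideal.span {a} ^ n ↔ a ^ n ∣ x := by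
  rw [Ideal.span_singleton_pow, Ideal.mem_span_singleton]

theorem eq_pow_mul_of_forall_eq_mul {x : A} {y : ℕ → A} (h : ∀ n, y n = x * y (n + 1)) (n k : ℕ) :
    y n = x ^ k * y (n + k) := by
  induction k with
  | zero => simp
  | succ k ih => rw [ih, h (n + k), pow_succ, mul_assoc, ← add_assoc]

/-- If `A` is `s`-adically complete, then the system `y_n - s y_{n+1} = g_n` has a solution. -/
theorem exists_forall_sub_mul_eq (s : A) [IsAdicComplete (Ideal.span {s}) A] (g : ℕ → A) :
    ∃ y : ℕ → A, ∀ n, y n - s * y (n + 1) = g n := by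
  -- The solution is `y_n = ∑ s^k g_{n+k}`.
  have h (n : ℕ) := exists_forall_sub_mem_pow (Ideal.span {s})
    (fun m ↦ ∑ k ∈ Finset.range m, s ^ k * g (n + k)) fun m ↦ by
      rw [Finset.sum_range_succ, add_sub_cancel_left, mem_span_singleton_pow]
      exact Dvd.intro _ rfl
  choose y hy using h
  refine ⟨y, fun n ↦ ?_⟩
  rw [← sub_eq_zero]
  refine eq_zero_of_forall_mem_pow (I := Ideal.span {s}) fun m ↦ ?_
  have h1 := Ideal.pow_le_pow_right (Nat.le_succ m) (hy n (m + 1))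
  have h2 := Ideal.mul_mem_left _ s (hy (n + 1) m)
  have h3 : ∑ k ∈ Finset.range (m + 1), s ^ k * g (n + k) =
      g n + s * ∑ k ∈ Finset.range m, s ^ k * g (n + 1 + k) := by
    rw [Finset.sum_range_succ', Finset.mul_sum, add_comm]
    congr 1
    · simp
    · refine Finset.sum_congr rfl fun k _ ↦ ?_
      rw [pow_succ, show n + (k + 1) = n + 1 + k by ring]
      ring
  rw [h3] at h1
  convert sub_mem h2 h1 using 1
  ring

/-- Let `q` be a nonzerodivisor such that `A` is `q`-adically complete. If `ξ` is a nonzerodivisor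
and `A / q` is `ξ`-adically complete, then `A` is `ξ`-adically complete. -/
theorem isAdicComplete_span_of_ker_eq {S : Type*} [CommRing S] {q ξ : A} (φ : A →+* S)
    (hφ : Function.Surjective φ) (hker : RingHom.ker φ = Ideal.span {q})
    [IsAdicComplete (Ideal.span {q}) A] [IsAdicComplete (Ideal.span {φ ξ}) S]
    (hq : ∀ x, q * x = 0 → x = 0) (hξ : ∀ x, ξ * x = 0 → x = 0) :
    IsAdicComplete (Ideal.span {ξ}) A := by
  have hdvd : ∀ x, φ x = 0 → ∃ y, x = q * y := fun x hx ↦ by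
    rw [← RingHom.mem_ker, hker, Ideal.mem_span_singleton] at hx
    exact hx
  have hφq : φ q = 0 := by
    rw [← RingHom.mem_ker, hker]
    exact Ideal.mem_span_singleton_self q
  refine isAdicComplete_of_forall (fun x hx ↦ ?_) fun f hf ↦ ?_
  · -- the sequences `y` with `y_n = ξ y_{n+1}` are divisible by `q`
    have key : ∀ (N : ℕ) (y : ℕ → A), (∀ n, y n = ξ * y (n + 1)) → ∀ n, q ^ N ∣ y n := by
      intro N
      induction N with
      | zero => simp
      | succ N ih =>
        intro y hy n
        have h0 : ∀ n, φ (y n) = 0 := fun n ↦ by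
          refine eq_zero_of_forall_mem_pow (I := Ideal.span {φ ξ}) fun k ↦ ?_
          rw [mem_span_singleton_pow, eq_pow_mul_of_forall_eq_mul hy n k, map_mul, map_pow]
          exact Dvd.intro _ rfl
        choose z hz using fun n ↦ hdvd _ (h0 n)
        rw [hz n, pow_succ']
        refine mul_dvd_mul_left q (ih z (fun n ↦ ?_) n)
        rw [← sub_eq_zero]
        apply hq
        rw [mul_sub, ← hz n, hy n, hz (n + 1)]
        ring
    simp only [mem_span_singleton_pow] at hx
    choose y hy using hx
    -- Cancelling `ξ ^ n` turns the separate quotients `x / ξ ^ n` into one chain.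
    have hy' : ∀ n, y n = ξ * y (n + 1) := by
      have hcancel : ∀ n x, ξ ^ n * x = 0 → x = 0 := by
        intro n
        induction n with
        | zero => simp
        | succ n ih =>
          intro x hx
          rw [pow_succ, mul_assoc] at hx
          exact hξ _ (ih _ hx)
      intro n
      rw [← sub_eq_zero]
      refine hcancel n _ ?_
      rw [mul_sub, ← hy n, ← mul_assoc, ← pow_succ, ← hy (n + 1), sub_self]
    have hx0 : x = y 0 := by simpa using hy 0
    refine eq_zero_of_forall_mem_pow (I := Ideal.span {q}) fun N ↦ ?_
    rw [mem_span_singleton_pow, hx0]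
    exact key N y hy' 0
  -- The limit comes from solving `L_n - ξ L_{n+1} = g_n`, where `f_{n+1} - f_n = ξ^n g_n`. The
  -- system is solvable modulo `q`; the error is divided by `q` and treated as a new right-hand
  -- side.
  · have hsol : ∀ g : ℕ → A, ∃ y g' : ℕ → A, ∀ n, g n - (y n - ξ * y (n + 1)) = q * g' n := by
      intro g
      obtain ⟨v, hv⟩ := exists_forall_sub_mul_eq (φ ξ) fun n ↦ φ (g n)
      choose y hy using fun n ↦ hφ (v n)
      have : ∀ n, φ (g n - (y n - ξ * y (n + 1))) = 0 := fun n ↦ by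
        simp only [map_sub, map_mul, hy, hv, sub_self]
      choose g' hg' using fun n ↦ hdvd _ (this n)
      exact ⟨y, g', hg'⟩
    choose Y G hYG using hsol
    simp only [mem_span_singleton_pow] at hf ⊢
    choose g hg using hf
    let s : ℕ → ℕ → A := fun m n ↦ ∑ k ∈ Finset.range m, q ^ k * Y (G^[k] g) n
    have hs : ∀ m n, g n - (s m n - ξ * s m (n + 1)) = q ^ m * (G^[m] g) n := by
      intro m n
      induction m with
      | zero => simp [s]
      | succ m ih =>
        have h1 := hYG (G^[m] g) n
        simp only [s, Finset.sum_range_succ] at ih ⊢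
        rw [Function.iterate_succ_apply', pow_succ, mul_assoc, ← h1]
        linear_combination ih
    have hlim (n : ℕ) := exists_forall_sub_mem_pow (Ideal.span {q}) (fun m ↦ s m n) fun m ↦ by
      simp only [s]
      rw [Finset.sum_range_succ, add_sub_cancel_left, mem_span_singleton_pow]
      exact Dvd.intro _ rfl
    choose L hL using hlim
    have hLg : ∀ n, g n = L n - ξ * L (n + 1) := fun n ↦ by
      rw [← sub_eq_zero]
      refine eq_zero_of_forall_mem_pow (I := Ideal.span {q}) fun m ↦ ?_
      have h1 : q ^ m * (G^[m] g) n ∈ Ideal.span {q} ^ m :=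
        mem_span_singleton_pow.mpr (Dvd.intro _ rfl)
      rw [← hs m n] at h1
      have h2 := sub_mem (add_mem h1 (hL n m)) (Ideal.mul_mem_left _ ξ (hL (n + 1) m))
      ring_nf at h2 ⊢
      exact h2
    refine ⟨f 0 + L 0, fun n ↦ ⟨-L n, ?_⟩⟩
    induction n with
    | zero => simp
    | succ n ih =>
      have h1 := hg n
      rw [hLg n] at h1
      rw [pow_succ]
      linear_combination h1 + ih

end AdicComplete

/-! ### The tilt: roots, perfectness and completeness -/

section Tilt

variable (p : ℕ) [Fact p.Prime] {R : Type*} [CommRing R]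

theorem Tilt.ext {x y : Tilt p R} (h : ∀ n, Tilt.coeff p n x = Tilt.coeff p n y) : x = y :=
  Subtype.ext (funext h)

theorem Tilt.coeff_succ_pow (x : Tilt p R) (n : ℕ) :
    Tilt.coeff p (n + 1) x ^ p = Tilt.coeff p n x :=
  x.2 n

theorem Tilt.coeff_add_pow (x : Tilt p R) (n k : ℕ) :
    Tilt.coeff p (n + k) x ^ p ^ k = Tilt.coeff p n x := by
  induction k with
  | zero => simp
  | succ k ih => rw [pow_succ', pow_mul, ← add_assoc, coeff_succ_pow, ih]

/-- The `p ^ k`-th root `(x_k, x_{k+1}, …)` of `(x_0, x_1, …)`. -/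
def Tilt.shift (k : ℕ) (x : Tilt p R) : Tilt p R :=
  ⟨fun n ↦ Tilt.coeff p (n + k) x, fun n ↦ by
    have := Tilt.coeff_succ_pow p x (n + k)
    rwa [add_right_comm] at this⟩

theorem Tilt.coeff_shift (k n : ℕ) (x : Tilt p R) :
    Tilt.coeff p n (Tilt.shift p k x) = Tilt.coeff p (n + k) x :=
  rfl

theorem Tilt.shift_pow (k : ℕ) (x : Tilt p R) : Tilt.shift p k x ^ p ^ k = x :=
  Tilt.ext p fun n ↦ by rw [map_pow, coeff_shift, coeff_add_pow]

theorem Tilt.subsingleton [Subsingleton (ModP p R)] : Subsingleton (Tilt p R) :=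
  ⟨fun _ _ ↦ Tilt.ext p fun _ ↦ Subsingleton.elim _ _⟩

theorem charP_of_natCast_eq_zero {S : Type*} [CommRing S] [Nontrivial S] (h : (p : S) = 0) :
    CharP S p := by
  obtain ⟨q, hq⟩ := CharP.exists S
  have h1 : q ∣ p := (CharP.cast_eq_zero_iff S q p).mp h
  rcases (Nat.dvd_prime Fact.out).mp h1 with rfl | rfl
  · exact (CharP.false_of_nontrivial_of_char_one (R := S)).elim
  · exact hq

theorem charP_quotient {S : Type*} [CommRing S] [CharP S p] {I : Ideal S} (hI : I ≠ ⊤) :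
    CharP (S ⧸ I) p := by
  have : Nontrivial (S ⧸ I) := Ideal.Quotient.nontrivial_iff.mpr hI
  refine charP_of_natCast_eq_zero p ?_
  rw [← map_natCast (Ideal.Quotient.mk I), CharP.cast_eq_zero, map_zero]

instance Tilt.charP [CharP (ModP p R) p] : CharP (Tilt p R) p := by
  have : Nontrivial (ModP p R) := CharP.nontrivial_of_char_ne_one (Fact.out : p.Prime).ne_one
  have : Nontrivial (Tilt p R) :=
    ⟨0, 1, fun h ↦ zero_ne_one (α := ModP p R) (by
      simpa using congrArg (Tilt.coeff p 0) h)⟩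
  refine charP_of_natCast_eq_zero p (Tilt.ext p fun n ↦ ?_)
  rw [map_natCast, map_zero, CharP.cast_eq_zero]

instance Tilt.perfectRing : PerfectRing (Tilt p R) p where
  bijective_frobenius := by
    refine ⟨fun x y h ↦ Tilt.ext p fun n ↦ ?_, fun x ↦ ⟨Tilt.shift p 1 x, ?_⟩⟩
    · rw [← coeff_succ_pow, ← coeff_succ_pow p y, ← map_pow, ← map_pow]
      exact congrArg _ h
    · simpa using Tilt.shift_pow p 1 x

instance Tilt.isReduced : IsReduced (Tilt p R) where
  eq_zero x := by
    rintro ⟨n, hn⟩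
    refine Tilt.ext p fun k ↦ ?_
    rw [← coeff_add_pow p x k n, ← map_pow,
      pow_eq_zero_of_le (Nat.lt_pow_self (Fact.out : p.Prime).one_lt).le hn, map_zero, map_zero]

theorem Tilt.coeff_zero_surjective (h : Function.Surjective (frob p R)) :
    Function.Surjective (Tilt.coeff (R := R) p 0) := by
  choose r hr using h
  exact fun x ↦ ⟨⟨fun n ↦ r^[n] x, fun n ↦ by
    change r^[n + 1] x ^ p = r^[n] x
    rw [Function.iterate_succ_apply']
    exact hr _⟩, rfl⟩

/-- If the kernel of `R♭ → R / p` is generated by `s`, then `R♭` is `s`-adically complete. -/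
theorem Tilt.isAdicComplete_span (s : Tilt p R)
    (hs : RingHom.ker (Tilt.coeff (R := R) p 0) = Ideal.span {s}) :
    IsAdicComplete (Ideal.span {s}) (Tilt p R) := by
  -- The case `n = 0` is the hypothesis; `p ^ n`-th roots shift coordinate `n` to coordinate `0`.
  have hker : ∀ n (x : Tilt p R), Tilt.coeff p n x = 0 ↔ s ^ p ^ n ∣ x := by
    intro n x
    constructor
    · intro hx
      have h1 : Tilt.shift p n x ∈ RingHom.ker (Tilt.coeff (R := R) p 0) := by
        rw [RingHom.mem_ker, coeff_shift, zero_add, hx]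
      rw [hs, Ideal.mem_span_singleton] at h1
      rw [← shift_pow p n x]
      exact pow_dvd_pow_of_dvd h1 _
    · rintro ⟨t, rfl⟩
      have h1 : Tilt.coeff p 0 s = 0 := by
        rw [← RingHom.mem_ker, hs]
        exact Ideal.mem_span_singleton_self s
      have h2 := coeff_add_pow p s 0 n
      rw [zero_add] at h2
      rw [map_mul, map_pow, h2, h1, zero_mul]
  have hp : ∀ n, n ≤ p ^ n := fun n ↦ (Nat.lt_pow_self (Fact.out : p.Prime).one_lt).le
  refine isAdicComplete_of_forall (fun x hx ↦ ?_) fun f hf ↦ ?_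
  · refine Tilt.ext p fun n ↦ ?_
    rw [map_zero, hker]
    exact mem_span_singleton_pow.mp (hx _)
  · have hf' : ∀ m k, s ^ m ∣ f (m + k) - f m := by
      intro m k
      induction k with
      | zero => simp
      | succ k ih =>
        have h1 := (pow_dvd_pow s (Nat.le_add_right m k)).trans
          (mem_span_singleton_pow.mp (hf (m + k)))
        have := dvd_add h1 ih
        rwa [sub_add_sub_cancel] at this
    have hf'' : ∀ m n, m ≤ n → s ^ m ∣ f n - f m := by
      intro m n hmn
      obtain ⟨k, rfl⟩ := Nat.exists_eq_add_of_le hmn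
      exact hf' m k
    -- Coordinate `n` only sees classes modulo `s ^ p ^ n`, and `f` is constant modulo that from
    -- index `p ^ n` on.
    let L : Tilt p R := ⟨fun n ↦ Tilt.coeff p n (f (p ^ n)), fun n ↦ by
      rw [coeff_succ_pow, ← sub_eq_zero, ← map_sub, hker]
      exact hf'' _ _ (Nat.pow_le_pow_right (Fact.out : p.Prime).pos n.le_succ)⟩
    refine ⟨L, fun n ↦ mem_span_singleton_pow.mpr ?_⟩
    have h1 : s ^ p ^ n ∣ f (p ^ n) - L := by
      rw [← hker, map_sub, sub_eq_zero]
      rfl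
    have := dvd_sub ((pow_dvd_pow s (hp n)).trans h1) (hf'' n (p ^ n) (hp n))
    rwa [sub_sub_sub_cancel_left] at this

end Tilt

/-! ### Surjectivity of `θ` and the generator of its kernel -/

section Theta

variable (p : ℕ) [Fact p.Prime] {R : Type*} [CommRing R]

theorem mk_theta_of_map_eq [IsAdicComplete (Ideal.span {(p : R)}) R] (n : ℕ) (x : AInf p R)
    (z : WittVector p R) (hz : WittVector.map (Ideal.Quotient.mk (Ideal.span {(p : R)})) z =
      WittVector.map (Tilt.coeff p n) x) :
    theta p R x - WittVector.ghostComponent n z ∈ Ideal.span {(p : R)} ^ (n + 1) := by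
  rw [← Ideal.Quotient.eq, mk_theta, thetaMod, RingHom.comp_apply, ← hz,
    WittVector.ghostComponentModPPow_map_mk]

theorem mk_theta_eq_coeff_zero [IsAdicComplete (Ideal.span {(p : R)}) R] (x : AInf p R) :
    Ideal.Quotient.mk (Ideal.span {(p : R)}) (theta p R x) = Tilt.coeff p 0 (x.coeff 0) := by
  obtain ⟨z, hz⟩ := WittVector.map_surjective (p := p) (Ideal.Quotient.mk (Ideal.span {(p : R)}))
    Ideal.Quotient.mk_surjective (WittVector.map (Tilt.coeff p 0) x)
  have h1 := mk_theta_of_map_eq p 0 x z hz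
  have h2 := congrArg (fun w ↦ WittVector.coeff w 0) hz
  simp only [WittVector.map_coeff] at h2
  rw [zero_add, pow_one, ← Ideal.Quotient.eq] at h1
  rw [h1, ← h2]
  simp [WittVector.ghostComponent_apply, wittPolynomial_zero]

theorem AInf.isAdicComplete : IsAdicComplete (Ideal.span {(p : AInf p R)}) (AInf p R) := by
  rcases subsingleton_or_charP p R with h | h
  · have := Tilt.subsingleton p (R := R)
    have : Subsingleton (AInf p R) := ⟨fun _ _ ↦ WittVector.ext fun _ ↦ Subsingleton.elim _ _⟩
    infer_instance
  · infer_instance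

/-- Modulo `p` the map is `R♭ → R/p` on the zeroth coefficient. Surjectivity lifts because the
source is `p`-complete and the target `p`-separated. -/
theorem theta_surjective [IsAdicComplete (Ideal.span {(p : R)}) R]
    (h : Function.Surjective (frob p R)) : Function.Surjective (theta p R) := by
  have hmap : Ideal.map (theta p R) (Ideal.span {(p : AInf p R)}) = Ideal.span {(p : R)} := by
    rw [Ideal.map_span, Set.image_singleton, map_natCast]
  have := AInf.isAdicComplete p (R := R)
  have : IsHausdorff ((Ideal.span {(p : AInf p R)}).map (theta p R)) R := by
    rw [hmap]
    infer_instance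
  refine surjective_of_mk_map_comp_surjective (theta p R) (I := Ideal.span {(p : AInf p R)}) ?_
  rw [hmap]
  intro y
  obtain ⟨a, rfl⟩ := Tilt.coeff_zero_surjective p h y
  refine ⟨WittVector.teichmuller p a, ?_⟩
  rw [RingHom.comp_apply, mk_theta_eq_coeff_zero, WittVector.teichmuller_coeff_zero]

/-- If `a` dies in `R/p`, then `θ([a]) = p θ(b)` for some `b`, so `[a] - p b` is a multiple of `ξ`;
its zeroth coefficient is `a`. -/
theorem ker_coeff_zero_eq_span [IsAdicComplete (Ideal.span {(p : R)}) R] [CharP (ModP p R) p]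
    (h : Function.Surjective (frob p R)) {ξ : AInf p R}
    (hξ : RingHom.ker (theta p R) = Ideal.span {ξ}) :
    RingHom.ker (Tilt.coeff (R := R) p 0) = Ideal.span {ξ.coeff 0} := by
  refine le_antisymm (fun a ha ↦ ?_) ?_
  · have h1 := mk_theta_eq_coeff_zero p (WittVector.teichmuller p a)
    rw [WittVector.teichmuller_coeff_zero, RingHom.mem_ker.mp ha, Ideal.Quotient.eq_zero_iff_dvd]
      at h1
    obtain ⟨r, hr⟩ := h1
    obtain ⟨b, rfl⟩ := theta_surjective p h r
    have h2 : WittVector.teichmuller p a - p * b ∈ RingHom.ker (theta p R) := by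
      rw [RingHom.mem_ker, map_sub, map_mul, map_natCast, hr, sub_self]
    rw [hξ, Ideal.mem_span_singleton] at h2
    obtain ⟨c, hc⟩ := h2
    have h3 := congrArg WittVector.constantCoeff hc
    simp only [map_sub, map_mul, map_natCast, WittVector.constantCoeff_apply,
      WittVector.teichmuller_coeff_zero, CharP.cast_eq_zero, zero_mul, sub_zero] at h3
    rw [h3]
    exact Ideal.mul_mem_right _ _ (Ideal.mem_span_singleton_self _)
  · rw [Ideal.span_singleton_le_iff_mem, RingHom.mem_ker, ← mk_theta_eq_coeff_zero]
    have : ξ ∈ RingHom.ker (theta p R) := hξ ▸ Ideal.mem_span_singleton_self ξ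
    rw [RingHom.mem_ker.mp this, map_zero]

/-- A Witt vector with `ξ₀ = ξ₁ = 0` does not divide `p`. -/
theorem natCast_ne_mul_of_coeff_eq_zero {k : Type*} [CommRing k] [Nontrivial k] [CharP k p]
    {ξ : WittVector p k} (h0 : ξ.coeff 0 = 0) (h1 : ξ.coeff 1 = 0) (a : WittVector p k) :
    (p : WittVector p k) ≠ ξ * a := by
  intro h
  have h2 : ξ ∈ RingHom.ker (WittVector.truncate (p := p) (R := k) 2) := by
    rw [WittVector.mem_ker_truncate]
    intro i hi
    interval_cases i
    · exact h0
    · exact h1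
  have h3 := Ideal.mul_mem_right a _ h2
  rw [← h, WittVector.mem_ker_truncate] at h3
  have h4 := h3 1 one_lt_two
  rw [WittVector.coeff_p_one] at h4
  exact one_ne_zero h4

/-- Since `p` lies in `π ^ p R`, some `p - [c]^p x` is a multiple of `ξ`, with `c` lifting `π`
modulo `p`. At a maximal ideal containing `ξ₁`, both `ξ₀` and `c` vanish too, so `p` would be a
multiple of a Witt vector whose first two coefficients are zero. -/
theorem isUnit_coeff_one_of_ker_eq_span [CharP (ModP p R) p] (hR : IsPerfectoid p R)
    [IsAdicComplete (Ideal.span {(p : R)}) R] {ξ : AInf p R}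
    (hξ : RingHom.ker (theta p R) = Ideal.span {ξ}) : IsUnit (ξ.coeff 1) := by
  obtain ⟨π, hpπ, hπ⟩ := hR.exists_pi
  obtain ⟨t, ht⟩ := Ideal.mem_span_singleton.mp hpπ
  have hjac : ∀ y, IsUnit (π * y + 1) := Ideal.mem_jacobson_bot.mp
    (IsAdicComplete.le_jacobson_bot (Ideal.span {π}) (Ideal.mem_span_singleton_self π))
  have hker := ker_coeff_zero_eq_span p hR.frob_surjective hξ
  have hS := Tilt.isAdicComplete_span p _ hker
  obtain ⟨c, hc⟩ := Tilt.coeff_zero_surjective p hR.frob_surjective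
    (Ideal.Quotient.mk (Ideal.span {(p : R)}) π)
  by_contra hunit
  obtain ⟨m, hm, h1m⟩ := exists_max_ideal_of_mem_nonunits hunit
  have h0m : ξ.coeff 0 ∈ m := by
    have := IsAdicComplete.le_jacobson_bot (Ideal.span {ξ.coeff 0})
      (Ideal.mem_span_singleton_self _)
    rw [Ideal.jacobson, Ideal.mem_sInf] at this
    exact this ⟨bot_le, hm⟩
  -- Otherwise `s c + u = 1` with `u ∈ m`. The image of `u` in `R/p` is `1 - π r`, a unit, so `u` is
  -- invertible modulo `ξ₀ ∈ m`.
  have hcm : c ∈ m := by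
    by_contra hcm
    obtain ⟨s, u, hu, hsu⟩ := hm.exists_inv hcm
    obtain ⟨r, hr⟩ := Ideal.Quotient.mk_surjective (Tilt.coeff p 0 s)
    have h2 : Tilt.coeff p 0 u = Ideal.Quotient.mk _ (π * (-r) + 1) := by
      have := congrArg (Tilt.coeff p 0) hsu
      rw [map_add, map_mul, map_one, hc, ← hr] at this
      rw [map_add, map_mul, map_one, map_neg]
      linear_combination this
    obtain ⟨v, hv⟩ := ((hjac (-r)).map (Ideal.Quotient.mk (Ideal.span {(p : R)}))).exists_right_inv
    obtain ⟨w, rfl⟩ := Tilt.coeff_zero_surjective p hR.frob_surjective v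
    have h3 : u * w - 1 ∈ RingHom.ker (Tilt.coeff (R := R) p 0) := by
      rw [RingHom.mem_ker, map_sub, map_mul, map_one, h2, hv, sub_self]
    rw [hker] at h3
    have h4 := (Ideal.span_singleton_le_iff_mem m).mpr h0m h3
    have h5 := sub_mem (Ideal.mul_mem_right w m hu) h4
    rw [sub_sub_cancel] at h5
    exact hm.ne_top ((Ideal.eq_top_iff_one m).mpr h5)
  have hp2 := (Fact.out : p.Prime).two_le
  -- Since `θ([c]) ≡ π` modulo `p` and `p ∈ π ^ p R` with `p ≥ 2`, `θ([c])` is `π` times a unit.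
  have h6 : ∃ x : AInf p R, (p : R) = theta p R (WittVector.teichmuller p c ^ p * x) := by
    have h7 := mk_theta_eq_coeff_zero p (WittVector.teichmuller p c)
    rw [WittVector.teichmuller_coeff_zero, hc, Ideal.Quotient.eq, Ideal.mem_span_singleton] at h7
    obtain ⟨r, hr⟩ := h7
    obtain ⟨v, hv⟩ := (hjac (π ^ (p - 2) * t * r)).exists_right_inv
    have h8 : theta p R (WittVector.teichmuller p c) = π * (π * (π ^ (p - 2) * t * r) + 1) := by
      have : π ^ p = π * (π * π ^ (p - 2)) := by
        rw [← pow_succ', ← pow_succ']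
        congr 1
        lia
      linear_combination hr + r * ht + t * r * this
    obtain ⟨x, hx⟩ := theta_surjective p hR.frob_surjective (v ^ p * t)
    refine ⟨x, ?_⟩
    rw [map_mul, map_pow, h8, hx, mul_pow, mul_assoc, ← mul_assoc _ (v ^ p), ← mul_pow, hv,
      one_pow, one_mul]
    exact ht
  obtain ⟨x, hx⟩ := h6
  have h9 : (p : AInf p R) - WittVector.teichmuller p c ^ p * x ∈ RingHom.ker (theta p R) := by
    rw [RingHom.mem_ker, map_sub, map_natCast, ← hx, sub_self]
  rw [hξ, Ideal.mem_span_singleton] at h9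
  obtain ⟨a, ha⟩ := h9
  let φ := WittVector.map (p := p) (Ideal.Quotient.mk m)
  have : Nontrivial (Tilt p R ⧸ m) := Ideal.Quotient.nontrivial_iff.mpr hm.ne_top
  have := charP_quotient p hm.ne_top
  refine natCast_ne_mul_of_coeff_eq_zero p (ξ := φ ξ) ?_ ?_ (φ a) ?_
  · rw [WittVector.map_coeff, Ideal.Quotient.eq_zero_iff_mem]
    exact h0m
  · rw [WittVector.map_coeff, Ideal.Quotient.eq_zero_iff_mem]
    exact h1m
  · rw [← map_mul, ← ha, map_sub, map_natCast, map_mul, map_pow, WittVector.map_teichmuller,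
      Ideal.Quotient.eq_zero_iff_mem.mpr hcm, WittVector.teichmuller_zero,
      zero_pow (Fact.out : p.Prime).ne_zero, zero_mul, sub_zero]

/-- For each prime `q` of `S`, `W(S/q)` is a domain in which `ξ` stays nonzero. Thus the
coefficients of `b` lie in every prime, and `S` is reduced. -/
theorem eq_zero_of_mul_eq_zero_of_isUnit_coeff {S : Type*} [CommRing S] [CharP S p]
    [IsReduced S] {ξ b : WittVector p S} (n : ℕ) (hξ : IsUnit (ξ.coeff n)) (h : ξ * b = 0) :
    b = 0 := by
  ext i
  rw [WittVector.zero_coeff]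
  refine IsNilpotent.eq_zero (nilpotent_iff_mem_prime.mpr fun q hq ↦ ?_)
  have := charP_quotient p hq.ne_top
  have h1 := congrArg (WittVector.map (p := p) (Ideal.Quotient.mk q)) h
  rw [map_mul, map_zero, mul_eq_zero] at h1
  rcases h1 with h1 | h1
  · have h2 := congrArg (fun w ↦ WittVector.coeff w n) h1
    rw [WittVector.map_coeff, WittVector.zero_coeff, Ideal.Quotient.eq_zero_iff_mem] at h2
    exact (hq.ne_top (Ideal.eq_top_of_isUnit_mem q h2 hξ)).elim
  · have h2 := congrArg (fun w ↦ WittVector.coeff w i) h1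
    rwa [WittVector.map_coeff, WittVector.zero_coeff, Ideal.Quotient.eq_zero_iff_mem] at h2

theorem isAdicComplete_ker_theta [IsAdicComplete (Ideal.span {(p : R)}) R]
    (hR : IsPerfectoid p R) : IsAdicComplete (RingHom.ker (theta p R)) (AInf p R) := by
  rcases subsingleton_or_charP p R with h | h
  · have := Tilt.subsingleton p (R := R)
    have : Subsingleton (AInf p R) := ⟨fun _ _ ↦ WittVector.ext fun _ ↦ Subsingleton.elim _ _⟩
    infer_instance
  · obtain ⟨ξ, hξ⟩ := hR.ker_theta
    change RingHom.ker (theta p R) = Ideal.span {ξ} at hξ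
    have : IsAdicComplete (Ideal.span {WittVector.constantCoeff ξ}) (Tilt p R) :=
      Tilt.isAdicComplete_span p _ (ker_coeff_zero_eq_span p hR.frob_surjective hξ)
    rw [hξ]
    refine isAdicComplete_span_of_ker_eq (q := (p : AInf p R)) WittVector.constantCoeff
      (WittVector.constantCoeff_surjective p) WittVector.ker_constantCoeff (fun x hx ↦ ?_)
      fun x ↦ eq_zero_of_mul_eq_zero_of_isUnit_coeff p 1
        (isUnit_coeff_one_of_ker_eq_span p hR hξ)
    exact WittVector.eq_zero_of_p_mul_eq_zero x (by rwa [mul_comm])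

end Theta

/-! ### Invariance of the tilt under thickenings, and uniqueness -/

section UniversalProperty

variable (p : ℕ) {D R : Type*} [CommRing D] [CommRing R]

/-- The ring homomorphism `D / p → R / p` induced by `D → R`. -/
def modPMap (f : D →+* R) : ModP p D →+* ModP p R :=
  Ideal.quotientMap _ f (by
    rw [Ideal.span_singleton_le_iff_mem, Ideal.mem_comap, map_natCast]
    exact Ideal.mem_span_singleton_self _)

theorem modPMap_mk (f : D →+* R) (x : D) :
    modPMap p f (Ideal.Quotient.mk _ x) = Ideal.Quotient.mk _ (f x) :=
  Ideal.quotientMap_mk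

theorem map_mem_span_pow (f : D →+* R) {n : ℕ} {x : D} (hx : x ∈ Ideal.span {(p : D)} ^ n) :
    f x ∈ Ideal.span {(p : R)} ^ n := by
  rw [mem_span_singleton_pow] at hx ⊢
  simpa using map_dvd f hx

variable [Fact p.Prime]

/-- The ring homomorphism `D♭ → R♭` induced by `D → R`. -/
def tiltMap (f : D →+* R) : Tilt p D →+* Tilt p R :=
  RingHom.codRestrict ((RingHom.pi fun n ↦ (modPMap p f).comp (Tilt.coeff p n))) (tiltSubring p R)
    fun x n ↦ by
      change modPMap p f _ ^ p = modPMap p f _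
      rw [← map_pow, Tilt.coeff_succ_pow]

theorem coeff_tiltMap (f : D →+* R) (n : ℕ) (x : Tilt p D) :
    Tilt.coeff p n (tiltMap p f x) = modPMap p f (Tilt.coeff p n x) :=
  rfl

/-- Fontaine's map is natural. -/
theorem map_theta [IsAdicComplete (Ideal.span {(p : D)}) D]
    [IsAdicComplete (Ideal.span {(p : R)}) R] (f : D →+* R) (x : AInf p D) :
    f (theta p D x) = theta p R (WittVector.map (tiltMap p f) x) := by
  rw [← sub_eq_zero]
  refine eq_zero_of_forall_mem_pow (I := Ideal.span {(p : R)}) fun n ↦ ?_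
  refine Ideal.pow_le_pow_right n.le_succ ?_
  obtain ⟨z, hz⟩ := WittVector.map_surjective (p := p) (Ideal.Quotient.mk (Ideal.span {(p : D)}))
    Ideal.Quotient.mk_surjective (WittVector.map (Tilt.coeff p n) x)
  have hz' : WittVector.map (Ideal.Quotient.mk (Ideal.span {(p : R)})) (WittVector.map f z) =
      WittVector.map (Tilt.coeff p n) (WittVector.map (tiltMap p f) x) := by
    ext k
    have := congrArg (fun w ↦ modPMap p f (WittVector.coeff w k)) hz
    simp only [WittVector.map_coeff, modPMap_mk] at this
    simp only [WittVector.map_coeff, coeff_tiltMap, this]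
  have h1 := map_mem_span_pow p f (mk_theta_of_map_eq p n x z hz)
  have h2 := mk_theta_of_map_eq p n _ _ hz'
  rw [map_sub] at h1
  have h3 : f (WittVector.ghostComponent n z) =
      WittVector.ghostComponent n (WittVector.map f z) := by
    simp only [WittVector.ghostComponent_apply]
    exact MvPolynomial.comp_aeval_apply z.coeff f.toIntAlgHom _
  rw [h3] at h1
  simpa using sub_mem h1 h2

/-- If `D` is `K`-adically complete, then the ideal `⋂ (q D + K ^ n) / q D` of `D / q` has square
zero. -/
theorem exists_sq_eq_mul_of_forall_exists {K : Ideal D} [IsAdicComplete K D] {q g : D}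
    (hg : ∀ n, ∃ x y, y ∈ K ^ n ∧ g = q * x + y) : ∃ s, g ^ 2 = q * s := by
  choose x y hy hxy using hg
  have hsub : ∀ n, y n - y (n + 1) = q * (x (n + 1) - x n) := fun n ↦ by
    linear_combination hxy (n + 1) - hxy n
  -- The `x_n` need not converge, but `y_n^2 - y_{n+1}^2 = q (x_{n+1} - x_n)(y_n + y_{n+1})`, and
  -- these cofactors of `q` tend to zero.
  obtain ⟨s, hs⟩ := exists_forall_sub_mem_pow K
    (fun n ↦ ∑ k ∈ Finset.range n, (x (k + 1) - x k) * (y k + y (k + 1))) fun n ↦ by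
      rw [Finset.sum_range_succ, add_sub_cancel_left]
      exact Ideal.mul_mem_left _ _ (add_mem (hy n) (Ideal.pow_le_pow_right n.le_succ (hy (n + 1))))
  have htel : ∀ n, y 0 ^ 2 - y n ^ 2 =
      q * ∑ k ∈ Finset.range n, (x (k + 1) - x k) * (y k + y (k + 1)) := by
    intro n
    induction n with
    | zero => simp
    | succ n ih =>
      rw [Finset.sum_range_succ, mul_add, ← ih, ← mul_assoc, ← hsub]
      ring
  have h0 : y 0 ^ 2 = q * s := by
    rw [← sub_eq_zero]
    refine eq_zero_of_forall_mem_pow (I := K) fun n ↦ ?_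
    have h1 := add_mem (Ideal.mul_mem_left _ q (hs n)) (Ideal.mul_mem_left _ (y n) (hy n))
    convert h1 using 1
    linear_combination htel n
  refine ⟨q * x 0 ^ 2 + 2 * x 0 * y 0 + s, ?_⟩
  rw [hxy 0]
  linear_combination h0

theorem sub_pow_prime_pow (x y : ModP p D) (n : ℕ) :
    (x - y) ^ p ^ n = x ^ p ^ n - y ^ p ^ n := by
  induction n with
  | zero => simp
  | succ n ih =>
    rw [pow_succ, pow_mul, ih, pow_mul, pow_mul]
    exact map_sub (frob p D) _ _

/-- If `x` maps to zero, so do all its roots. Their Teichmüller images in `D` lie in `ker f`, so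
that of `x` lies in every power of `ker f` and vanishes. -/
theorem tiltMap_injective {f : D →+* R} [IsAdicComplete (Ideal.span {(p : R)}) R]
    [IsAdicComplete (Ideal.span {(p : D)}) D] [IsAdicComplete (RingHom.ker f) D] :
    Function.Injective (tiltMap p f) := by
  have key : ∀ x, tiltMap p f x = 0 → Tilt.coeff p 0 x = 0 := by
    intro x hx
    have h1 : ∀ n, theta p D (WittVector.teichmuller p (Tilt.shift p n x)) ∈ RingHom.ker f := by
      intro n
      have h2 : tiltMap p f (Tilt.shift p n x) = 0 := Tilt.ext p fun m ↦ by
        rw [coeff_tiltMap, Tilt.coeff_shift, ← coeff_tiltMap, hx, map_zero, map_zero]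
      rw [RingHom.mem_ker, map_theta, WittVector.map_teichmuller, h2, WittVector.teichmuller_zero,
        map_zero]
    have h3 : theta p D (WittVector.teichmuller p x) = 0 := by
      refine eq_zero_of_forall_mem_pow (I := RingHom.ker f) fun n ↦ ?_
      have h4 := Ideal.pow_mem_pow (h1 n) (p ^ n)
      rw [← map_pow, ← map_pow, Tilt.shift_pow] at h4
      exact Ideal.pow_le_pow_right (Nat.lt_pow_self (Fact.out : p.Prime).one_lt).le h4
    rw [← WittVector.teichmuller_coeff_zero p x, ← mk_theta_eq_coeff_zero, h3, map_zero]
  rw [injective_iff_map_eq_zero]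
  intro x hx
  refine Tilt.ext p fun n ↦ ?_
  have := key (Tilt.shift p n x) (Tilt.ext p fun m ↦ by
    rw [coeff_tiltMap, Tilt.coeff_shift, ← coeff_tiltMap, hx, map_zero, map_zero])
  rwa [Tilt.coeff_shift, zero_add] at this

/-- The powers `z_{n+m} ^ p ^ m` of lifts should converge to the components of the preimage, but
`D/p` need not be `ker f`-adically separated. Limits are taken in `D` instead; they are
Frobenius-compatible modulo `p` up to an error of square zero, which one more Frobenius kills. -/
theorem tiltMap_surjective {f : D →+* R} (hf : Function.Surjective f)
    [IsAdicComplete (RingHom.ker f) D] : Function.Surjective (tiltMap p f) := by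
  intro b
  let mk : D →+* ModP p D := Ideal.Quotient.mk _
  have hlift : ∀ n, ∃ z, modPMap p f (mk z) = Tilt.coeff p n b := fun n ↦ by
    obtain ⟨r, hr⟩ := Ideal.Quotient.mk_surjective (Tilt.coeff p n b)
    obtain ⟨z, rfl⟩ := hf r
    exact ⟨z, hr⟩
  choose z hz using hlift
  have hdiff : ∀ n, ∃ k ∈ RingHom.ker f, mk (z (n + 1)) ^ p = mk (z n) - mk k := by
    intro n
    have h1 : modPMap p f (mk (z n - z (n + 1) ^ p)) = 0 := by
      rw [map_sub, map_pow, map_sub, map_pow, hz, hz, Tilt.coeff_succ_pow, sub_self]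
    rw [modPMap_mk, Ideal.Quotient.eq_zero_iff_dvd] at h1
    obtain ⟨r, hr⟩ := h1
    obtain ⟨d, rfl⟩ := hf r
    refine ⟨z n - z (n + 1) ^ p - p * d, ?_, ?_⟩
    · rw [RingHom.mem_ker, map_sub, hr, map_mul, map_natCast, sub_self]
    · have h2 : mk (p * d) = 0 := Ideal.Quotient.eq_zero_iff_dvd _ _ |>.mpr (Dvd.intro _ rfl)
      rw [map_sub, h2, map_sub, map_pow]
      ring
  choose k hk hzk using hdiff
  -- A representative of `z_{n+m} ^ p ^ m` modulo `p`, chosen to be `ker f`-adically Cauchy in `m`.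
  let w : ℕ → ℕ → D := fun n m ↦ z n - ∑ i ∈ Finset.range m, k (n + i) ^ p ^ i
  have hw : ∀ n m, mk (w n m) = mk (z (n + m)) ^ p ^ m := by
    intro n m
    induction m with
    | zero => simp [w]
    | succ m ih =>
      rw [← add_assoc, pow_succ', pow_mul, hzk, sub_pow_prime_pow, ← ih, ← map_pow, ← map_sub]
      simp only [w, Finset.sum_range_succ]
      congr 1
      ring
  have hlim (n : ℕ) := exists_forall_sub_mem_pow (RingHom.ker f) (w n) fun m ↦ by
    simp only [w, Finset.sum_range_succ, sub_sub_sub_cancel_left]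
    rw [sub_add_cancel_left, neg_mem_iff]
    exact Ideal.pow_le_pow_right (Nat.lt_pow_self (Fact.out : p.Prime).one_lt).le
      (Ideal.pow_mem_pow (hk _) _)
  choose L hL using hlim
  have hfL : ∀ n, f (L n) = f (z n) := fun n ↦ by
    have h1 := hL n 1
    rw [pow_one, RingHom.mem_ker] at h1
    have h2 := hk n
    rw [RingHom.mem_ker] at h2
    simp [w, h2] at h1
    rw [← sub_eq_zero, ← neg_sub, h1, neg_zero]
  have hγ : ∀ n, mk (L n - L (n + 1) ^ p) ^ 2 = 0 := by
    intro n
    obtain ⟨s, hs⟩ := exists_sq_eq_mul_of_forall_exists (K := RingHom.ker f) (q := (p : D))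
      (g := L n - L (n + 1) ^ p) fun m ↦ by
        have h1 := hL n (m + 1)
        have h2 := hL (n + 1) m
        -- Both `w (n + 1) m ^ p` and `w n (m + 1)` represent `z_{n+m+1} ^ p ^ (m + 1)` modulo `p`.
        have h3 : mk (L n - L (n + 1) ^ p) =
            mk ((w (n + 1) m - L (n + 1)) ^ p - (w n (m + 1) - L n)) := by
          have h4 := sub_pow_prime_pow p (mk (w (n + 1) m)) (mk (L (n + 1))) 1
          rw [pow_one] at h4
          rw [map_sub, map_sub mk (_ ^ p), map_pow, map_pow, map_sub mk (w (n + 1) m), h4,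
            map_sub mk (w n (m + 1)), hw, hw, ← pow_mul, ← pow_succ, add_right_comm n 1 m, ← add_assoc]
          ring
        rw [Ideal.Quotient.eq, Ideal.mem_span_singleton] at h3
        obtain ⟨x, hx⟩ := h3
        exact ⟨x, _, sub_mem (Ideal.pow_mem_of_mem _ h2 p (Fact.out : p.Prime).pos)
          (Ideal.pow_le_pow_right m.le_succ h1), by rw [← hx, sub_add_cancel]⟩
    rw [← map_pow, hs, Ideal.Quotient.eq_zero_iff_dvd]
    exact Dvd.intro _ rfl
  -- The component is `L_{n+1}^p`, not `L_n`: the `p`-th power of the square-zero error vanishes as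
  -- `p ≥ 2`.
  refine ⟨⟨fun n ↦ mk (L (n + 1)) ^ p, fun n ↦ ?_⟩, Tilt.ext p fun n ↦ ?_⟩
  · have h1 := sub_pow_prime_pow p (mk (L (n + 1))) (mk (L (n + 2)) ^ p) 1
    rw [pow_one, ← map_pow mk (L (n + 2)), ← map_sub,
      pow_eq_zero_of_le (Fact.out : p.Prime).two_le (hγ (n + 1)), map_pow] at h1
    exact (sub_eq_zero.mp h1.symm).symm
  · change modPMap p f (mk (L (n + 1)) ^ p) = _
    rw [map_pow, modPMap_mk, hfL, ← modPMap_mk, hz, Tilt.coeff_succ_pow]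

theorem eq_of_comp_eq_theta {f : D →+* R} [IsAdicComplete (Ideal.span {(p : R)}) R]
    [IsAdicComplete (Ideal.span {(p : D)}) D] [IsAdicComplete (RingHom.ker f) D]
    {g h : AInf p R →+* D} (hg : f.comp g = theta p R) (hh : f.comp h = theta p R) : g = h := by
  -- The sequence `u([a^(1/p^n)])` modulo `p`, which is the preimage of `a` in `D♭` whenever `u`
  -- lies over `R`.
  let lift (u : AInf p R →+* D) (a : Tilt p R) : Tilt p D :=
    ⟨fun n ↦ Ideal.Quotient.mk _ (u (WittVector.teichmuller p (Tilt.shift p n a))), fun n ↦ by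
      rw [← map_pow, ← map_pow, ← map_pow]
      congr 3
      exact Tilt.ext p fun m ↦ by
        rw [map_pow, Tilt.coeff_shift, Tilt.coeff_shift, ← add_assoc, Tilt.coeff_succ_pow]⟩
  have hlift : ∀ u : AInf p R →+* D, f.comp u = theta p R → ∀ a, tiltMap p f (lift u a) = a :=
    fun u hu a ↦ Tilt.ext p fun n ↦ by
      rw [coeff_tiltMap]
      change modPMap p f (Ideal.Quotient.mk _ _) = _
      rw [modPMap_mk, ← RingHom.comp_apply f, hu, mk_theta_eq_coeff_zero,
        WittVector.teichmuller_coeff_zero, Tilt.coeff_shift, zero_add]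
  have hT : ∀ a n, g (WittVector.teichmuller p a) - h (WittVector.teichmuller p a) ∈
      Ideal.span {(p : D)} ^ n := by
    intro a n
    have h1 := congrArg (Tilt.coeff p n)
      (tiltMap_injective p ((hlift g hg a).trans (hlift h hh a).symm))
    replace h1 := dvd_sub_pow_of_dvd_sub
      (Ideal.mem_span_singleton.mp (Ideal.Quotient.eq.mp h1)) n
    rw [← map_pow g, ← map_pow h, ← map_pow, Tilt.shift_pow] at h1
    exact Ideal.pow_le_pow_right n.le_succ (mem_span_singleton_pow.mpr h1)
  rcases subsingleton_or_charP p R with hR | hR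
  · have := Tilt.subsingleton p (R := R)
    have : Subsingleton (AInf p R) := ⟨fun _ _ ↦ WittVector.ext fun _ ↦ Subsingleton.elim _ _⟩
    ext x
    rw [Subsingleton.elim x 0, map_zero, map_zero]
  · ext x
    rw [← sub_eq_zero]
    refine eq_zero_of_forall_mem_pow (I := Ideal.span {(p : D)}) fun n ↦ ?_
    -- Modulo `p ^ n`, where `p` is nilpotent, a homomorphism from `W` of a perfect ring is
    -- determined by its values on Teichmüller elements.
    have h1 := WittVector.eq_of_apply_teichmuller_eq
      ((Ideal.Quotient.mk (Ideal.span {(p : D)} ^ n)).comp g)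
      ((Ideal.Quotient.mk (Ideal.span {(p : D)} ^ n)).comp h)
      ⟨n, by
        rw [← map_natCast (Ideal.Quotient.mk _), ← map_pow, Ideal.Quotient.eq_zero_iff_mem]
        exact Ideal.pow_mem_pow (Ideal.mem_span_singleton_self _) n⟩
      fun a ↦ Ideal.Quotient.eq.mpr (hT a n)
    exact Ideal.Quotient.eq.mp (RingHom.congr_fun h1 x)

end UniversalProperty

end FontaineAInf

end

theorem mainTheorem7 (p : ℕ) [Fact p.Prime] (R : Type*) [CommRing R]
    (hR : FontaineAInf.IsPerfectoid p R) :
    FontaineAInf.IsProInfThickening p hR.theta ∧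
      ∀ (D : Type*) [CommRing D] (θD : D →+* R), FontaineAInf.IsProInfThickening p θD →
        ∃! f : FontaineAInf.AInf p R →+* D, θD.comp f = hR.theta := by
  have := FontaineAInf.isAdicComplete_of_exists_pi hR.exists_pi
  refine ⟨⟨FontaineAInf.theta_surjective p hR.frob_surjective, FontaineAInf.AInf.isAdicComplete p,
    FontaineAInf.isAdicComplete_ker_theta p hR⟩, fun D _ θD hD ↦ ?_⟩
  have := hD.p_complete
  have := hD.ker_complete
  let e := RingEquiv.ofBijective (FontaineAInf.tiltMap p θD)
    ⟨FontaineAInf.tiltMap_injective p, FontaineAInf.tiltMap_surjective p hD.surjective⟩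
  have hf : θD.comp ((FontaineAInf.theta p D).comp (WittVector.map e.symm.toRingHom)) =
      FontaineAInf.theta p R := by
    ext x
    rw [RingHom.comp_apply, RingHom.comp_apply, FontaineAInf.map_theta]
    congr 1
    refine WittVector.ext fun n ↦ ?_
    rw [WittVector.map_coeff, WittVector.map_coeff]
    exact e.apply_symm_apply _
  exact ⟨_, hf, fun g hg ↦ FontaineAInf.eq_of_comp_eq_theta p hg hf⟩
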